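/- Graphs are finite and may have loops and parallel edges; $V(G)$, $E(G)$ denote the vertex and edge sets of $G$, and $\Delta G = |E(G)| - |V(G)|$. For $X \subseteq E(G)$, $G\langle X\rangle$ is the subgraph whose edges are those in $X$ and whose vertices are the ends of the edges in $X$. For $k \ge 1$ let $\mathcal C_k(G)$ be the family of all $C \subseteq E(G)$ such that $\Delta G\langle C\rangle = k$ and $G\langle C\rangle$ has no isolated vertex, no vertex of degree $1$ (a loop counts twice in degrees) and no component that is a cycle. The family $\mathcal C_k(G)$ is the set of circuits of a matroid on $E(G)$, the $k$-circular matroid $M_k(G)$ of $G$; let $\rho^*_k(G)$ be its corank (the rank of its dual). For a vertex $v$ let $S(v,G)$ be the set of edges incident to $v$, $s(v,G) = |S(v,G)|$, and $\mathcal S(G) = \{S(v,G) : v \in V(G)\}$. A graph is $3$-connected if it has no loops (parallel edges are allowed) and at least four vertices, and remains connected after the deletion of any at most two vertices. Two graphs $G$, $G'$ with $E(G) = E(G')$ are strongly isomorphic if there is a bijection $\nu : V(G) \to V(G')$ such that an edge $e$ has ends $x, y$ in $G$ if and only if it has ends $\nu(x), \nu(y)$ in $G'$. **Theorem.** Let $G$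 and $G'$ be finite graphs, where $G'$ has no isolated vertices, let $t \in V(G)$, and let $k \ge 1$. Suppose that (a1) $G$ is $3$-connected, (a2) $\mathcal C_k(G) \neq \emptyset$, (a3) $s(t,G) = \rho^*_k(G) + 1$ (that is, $t$ is $k$-tight), and $s(x,G) \le \rho^*_k(G)$ for every vertex $x \ne t$ of $G$ (that is, $x$ is $k$-small), and (a4) $M_k(G') = M_k(G)$. Then $\mathcal S(G) = \mathcal S(G')$ and $G$ and $G'$ are strongly isomorphic. -/

import Mathlib

namespace Graph

variable {α β α' : Type*}

/-! ### Finite multigraphs -/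

/-- The degree of a vertex; a loop counts twice. -/
noncomputable def degree (G : Graph α β) (v : α) : ℕ :=
  (G.incidenceSet v).ncard + (G.loopSet v).ncard

/-- `G` is nonempty and any two of its vertices are joined by a walk. -/
def Connected (G : Graph α β) : Prop :=
  V(G).Nonempty ∧ ∀ x ∈ V(G), ∀ y ∈ V(G), Relation.ReflTransGen G.Adj x y

/-- A (finite) graph is a cycle if it is connected and all its degrees are two.
Loops (one vertex) and pairs of parallel edges (two vertices) are cycles. -/
def IsCycle (G : Graph α β) : Prop :=
  G.Connected ∧ ∀ v ∈ V(G), G.degree v = 2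

/-- `H` is a component of `G` that is a cycle. (`H ≤c G` says that `H` is a union of
components of `G`, so that a connected such `H` is one component.) -/
def IsCycleComponent (H G : Graph α β) : Prop :=
  H ≤c G ∧ H.IsCycle

/-- A cacti-graph: no isolated vertices, no leaves, no cycle components. -/
def IsCactiGraph (G : Graph α β) : Prop :=
  (∀ v ∈ V(G), G.degree v ≠ 0) ∧ (∀ v ∈ V(G), G.degree v ≠ 1) ∧
    ¬ ∃ H : Graph α β, H.IsCycleComponent G

/-- `Δ G = |E(G)| - |V(G)|`. -/
noncomputable def excess (G : Graph α β) : ℤ :=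
  (E(G).ncard : ℤ) - (V(G).ncard : ℤ)

/-- The subgraph `G⟨X⟩` induced by a set `X` of edges: its edges are those in `X`, and its vertices
are the ends of the edges in `X`. -/
def edgeInduce (G : Graph α β) (X : Set β) : Graph α β where
  vertexSet := {v | ∃ e ∈ X, G.Inc e v}
  edgeSet := E(G) ∩ X
  IsLink e x y := e ∈ X ∧ G.IsLink e x y
  isLink_symm _ _ := { symm _ _ h := ⟨h.1, h.2.symm⟩ }
  eq_or_eq_of_isLink_of_isLink _ _ _ _ _ h h' := h.2.left_eq_or_eq h'.2
  edge_mem_iff_exists_isLink e := by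
    constructor
    · rintro ⟨he, heX⟩
      obtain ⟨x, y, h⟩ := G.exists_isLink_of_mem_edgeSet he
      exact ⟨x, y, heX, h⟩
    · rintro ⟨x, y, heX, h⟩
      exact ⟨h.edge_mem, heX⟩
  left_mem_of_isLink e _ _ h := ⟨e, h.1, h.2.inc_left⟩

/-- The family `𝓒ₖ(G)` of edge sets `C` such that `G⟨C⟩` is a cacti-graph with `Δ G⟨C⟩ = k`. -/
def kCircuits (G : Graph α β) (k : ℕ) : Set (Set β) :=
  {C | C ⊆ E(G) ∧ (G.edgeInduce C).excess = k ∧ (G.edgeInduce C).IsCactiGraph}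

/-! ### Facts showing that `𝓒ₖ(G)` is the family of circuits of a matroid -/

section Aux

variable {G : Graph α β} {X Y A B : Set β}

theorem vertexSet_edgeInduce_finite (G : Graph α β) (hX : X.Finite) :
    V(G.edgeInduce X).Finite := by
  have h : V(G.edgeInduce X) = ⋃ e ∈ X, {v | G.Inc e v} := by
    ext v; simp [edgeInduce]
  rw [h]
  refine hX.biUnion fun e _ ↦ ?_
  by_cases he : e ∈ E(G)
  · obtain ⟨x, y, hxy⟩ := G.exists_isLink_of_mem_edgeSet he
    refine (Set.toFinite {x, y}).subset fun v hv ↦ ?_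
    exact hv.eq_or_eq_of_isLink hxy
  · simp [not_inc_of_notMem_edgeSet he]

theorem vertexSet_edgeInduce_mono (h : X ⊆ Y) : V(G.edgeInduce X) ⊆ V(G.edgeInduce Y) :=
  fun _ ⟨e, he, hv⟩ ↦ ⟨e, h he, hv⟩

theorem vertexSet_edgeInduce_union :
    V(G.edgeInduce (A ∪ B)) = V(G.edgeInduce A) ∪ V(G.edgeInduce B) := by
  ext v
  simp only [edgeInduce, Set.mem_union, Set.mem_ofPred_eq]
  grind

theorem excess_edgeInduce (h : X ⊆ E(G)) :
    (G.edgeInduce X).excess = (X.ncard : ℤ) - (V(G.edgeInduce X).ncard : ℤ) := by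
  have : E(G.edgeInduce X) = X := Set.inter_eq_right.2 h
  rw [excess, this]

theorem edgeInduce_inc {e : β} {v : α} :
    (G.edgeInduce X).Inc e v ↔ e ∈ X ∧ G.Inc e v := by
  simp [Inc, edgeInduce]

theorem excess_edgeInduce_supermodular (hE : E(G).Finite) (hA : A ⊆ E(G)) (hB : B ⊆ E(G)) :
    (G.edgeInduce A).excess + (G.edgeInduce B).excess ≤
      (G.edgeInduce (A ∪ B)).excess + (G.edgeInduce (A ∩ B)).excess := by
  rw [excess_edgeInduce hA, excess_edgeInduce hB, excess_edgeInduce (Set.union_subset hA hB),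
    excess_edgeInduce (Set.inter_subset_left.trans hA), vertexSet_edgeInduce_union]
  have hAf := hE.subset hA
  have hBf := hE.subset hB
  have h1 := Set.ncard_union_add_ncard_inter A B hAf hBf
  have h2 := Set.ncard_union_add_ncard_inter _ _ (G.vertexSet_edgeInduce_finite hAf)
    (G.vertexSet_edgeInduce_finite hBf)
  have h3 : V(G.edgeInduce (A ∩ B)).ncard ≤
      (V(G.edgeInduce A) ∩ V(G.edgeInduce B)).ncard :=
    Set.ncard_le_ncard (Set.subset_inter (vertexSet_edgeInduce_mono Set.inter_subset_left)
      (vertexSet_edgeInduce_mono Set.inter_subset_right))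
      ((G.vertexSet_edgeInduce_finite hAf).inter_of_left _)
  omega

open Classical in
/-- The number of ends of `e` in `W`, a loop having two ends. -/
noncomputable def endCount (G : Graph α β) (W : Finset α) (e : β) : ℕ :=
  (W.filter (G.Inc e)).card + (W.filter (G.IsLoopAt e)).card

theorem sum_degree_eq (hE : E(G).Finite) (W : Finset α) :
    ∑ v ∈ W, G.degree v = ∑ e ∈ hE.toFinset, G.endCount W e := by
  classical
  have h1 : ∀ v, (G.incidenceSet v).ncard = (hE.toFinset.filter (G.Inc · v)).card := by
    intro v
    rw [← Set.ncard_coe_finset]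
    congr 1
    ext e
    simp only [mem_incidenceSet, Finset.coe_filter, Set.Finite.mem_toFinset, Set.mem_ofPred_eq]
    exact ⟨fun h ↦ ⟨h.edge_mem, h⟩, fun h ↦ h.2⟩
  have h2 : ∀ v, (G.loopSet v).ncard = (hE.toFinset.filter (G.IsLoopAt · v)).card := by
    intro v
    rw [← Set.ncard_coe_finset]
    congr 1
    ext e
    simp only [mem_loopSet, Finset.coe_filter, Set.Finite.mem_toFinset, Set.mem_ofPred_eq]
    exact ⟨fun h ↦ ⟨h.edge_mem, h⟩, fun h ↦ h.2⟩
  simp only [degree, endCount, Finset.sum_add_distrib, h1, h2]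
  congr 1
  · exact (Finset.sum_card_bipartiteAbove_eq_sum_card_bipartiteBelow (s := hE.toFinset) (t := W)
      (fun e v ↦ G.Inc e v)).symm
  · exact (Finset.sum_card_bipartiteAbove_eq_sum_card_bipartiteBelow (s := hE.toFinset) (t := W)
      (fun e v ↦ G.IsLoopAt e v)).symm

theorem endCount_eq {e : β} {x y : α} (h : G.IsLink e x y) (W : Finset α) [DecidableEq α] :
    G.endCount W e = (if x ∈ W then 1 else 0) + (if y ∈ W then 1 else 0) := by
  classical
  have hinc : ∀ v, G.Inc e v ↔ v = x ∨ v = y := fun v ↦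
    ⟨fun hv ↦ hv.eq_or_eq_of_isLink h, by rintro (rfl | rfl); exacts [h.inc_left, h.inc_right]⟩
  have hloop : ∀ v, G.IsLoopAt e v ↔ v = x ∧ v = y := by
    intro v
    rw [← isLink_self_iff, h.isLink_iff]
    grind
  have e1 : W.filter (G.Inc e) = W.filter (fun v ↦ v = x ∨ v = y) :=
    Finset.filter_congr fun v _ ↦ hinc v
  have e2 : W.filter (G.IsLoopAt e) = W.filter (fun v ↦ v = x ∧ v = y) :=
    Finset.filter_congr fun v _ ↦ hloop v
  have e3 := Finset.card_union_add_card_inter (W.filter (· = x)) (W.filter (· = y))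
  rw [endCount, e1, e2, Finset.filter_or, Finset.filter_and, e3, Finset.filter_eq',
    Finset.filter_eq']
  split_ifs <;> simp

/-- In a cycle there are as many edges as vertices. -/
theorem IsCycle.ncard_eq (h : G.IsCycle) (hE : E(G).Finite) (hV : V(G).Finite) :
    E(G).ncard = V(G).ncard := by
  classical
  have h1 := sum_degree_eq hE hV.toFinset
  have h2 : ∑ v ∈ hV.toFinset, G.degree v = ∑ v ∈ hV.toFinset, 2 :=
    Finset.sum_congr rfl fun v hv ↦ h.2 v (by simpa using hv)
  have h3 : ∑ e ∈ hE.toFinset, G.endCount hV.toFinset e = ∑ e ∈ hE.toFinset, 2 := by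
    refine Finset.sum_congr rfl fun e he ↦ ?_
    obtain ⟨x, y, hxy⟩ := G.exists_isLink_of_mem_edgeSet (by simpa using he)
    rw [endCount_eq hxy]
    simp [hxy.left_mem, hxy.right_mem]
  rw [h2, h3] at h1
  simp only [Finset.sum_const, smul_eq_mul] at h1
  rw [Set.ncard_eq_toFinset_card _ hE, Set.ncard_eq_toFinset_card _ hV]
  omega

theorem exists_ssubset_of_notMem_kCircuits (hE : E(G).Finite) {k : ℕ} (hk : 1 ≤ k)
    (hX : X ⊆ E(G)) (hkX : k ≤ (G.edgeInduce X).excess) (hXC : X ∉ G.kCircuits k) :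
    ∃ Y, Y ⊂ X ∧ k ≤ (G.edgeInduce Y).excess := by
  have hXf := hE.subset hX
  have hVf := G.vertexSet_edgeInduce_finite hXf
  have hEX : E(G.edgeInduce X) = X := Set.inter_eq_right.2 hX
  have hne : X.Nonempty := by
    by_contra h
    rw [Set.not_nonempty_iff_eq_empty] at h
    subst h
    simp only [excess_edgeInduce (Set.empty_subset _), Set.ncard_empty] at hkX
    omega
  by_cases h1 : (G.edgeInduce X).excess = k
  swap
  · obtain ⟨e, he⟩ := hne
    refine ⟨X \ {e}, Set.sdiff_singleton_ssubset.2 he, ?_⟩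
    rw [excess_edgeInduce (Set.sdiff_subset.trans hX)]
    rw [excess_edgeInduce hX] at h1 hkX
    have h2 := Set.ncard_sdiff_singleton_add_one he hXf
    have h3 := Set.ncard_le_ncard (vertexSet_edgeInduce_mono (G := G)
      (Set.sdiff_subset : X \ {e} ⊆ X)) hVf
    omega
  rw [excess_edgeInduce hX] at hkX
  by_cases h2 : ∃ v ∈ V(G.edgeInduce X), (G.edgeInduce X).degree v ≤ 1
  · obtain ⟨v, ⟨e, heX, hev⟩, hd⟩ := h2
    have hfin : ((G.edgeInduce X).incidenceSet v).Finite :=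
      hXf.subset fun f hf ↦ (edgeInduce_inc.1 hf).1
    have hmem : e ∈ (G.edgeInduce X).incidenceSet v := edgeInduce_inc.2 ⟨heX, hev⟩
    have hle : ((G.edgeInduce X).incidenceSet v).ncard ≤ 1 := by
      rw [degree] at hd; omega
    rw [Set.ncard_le_one hfin] at hle
    have hss : X \ {e} ⊂ X := Set.sdiff_singleton_ssubset.2 heX
    refine ⟨X \ {e}, hss, ?_⟩
    rw [excess_edgeInduce (hss.subset.trans hX)]
    have hvss : V(G.edgeInduce (X \ {e})) ⊂ V(G.edgeInduce X) := by
      refine (vertexSet_edgeInduce_mono hss.subset).ssubset_of_mem_notMem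
        (a := v) ⟨e, heX, hev⟩ ?_
      rintro ⟨f, ⟨hfX, hfe⟩, hfv⟩
      exact hfe (hle f (edgeInduce_inc.2 ⟨hfX, hfv⟩) e hmem)
    have h3 := Set.ncard_sdiff_singleton_add_one heX hXf
    have h4 := Set.ncard_lt_ncard hvss hVf
    omega
  push Not at h2
  have h3 : ∃ H : Graph α β, H.IsCycleComponent (G.edgeInduce X) := by
    by_contra h
    refine hXC ⟨hX, h1, fun v hv ↦ ?_, fun v hv ↦ ?_, h⟩
    · have := h2 v hv; omega
    · have := h2 v hv; omega
  obtain ⟨H, hHc, hH⟩ := h3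
  have hHX : E(H) ⊆ X := by simpa only [hEX] using hHc.le.edgeSet_mono
  have hHV := hHc.le.vertexSet_mono
  have hcard := hH.ncard_eq (hXf.subset hHX) (hVf.subset hHV)
  have hVpos : 0 < V(H).ncard := (Set.ncard_pos (hVf.subset hHV)).2 hH.1.1
  obtain ⟨e, he⟩ : E(H).Nonempty := (Set.ncard_pos (hXf.subset hHX)).1 (by omega)
  have hss : X \ E(H) ⊂ X := Set.sdiff_subset.ssubset_of_mem_notMem (hHX he) (fun h ↦ h.2 he)
  refine ⟨X \ E(H), hss, ?_⟩
  rw [excess_edgeInduce (hss.subset.trans hX)]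
  have hsub : V(G.edgeInduce (X \ E(H))) ⊆ V(G.edgeInduce X) \ V(H) := by
    rintro v ⟨f, ⟨hfX, hfH⟩, hfv⟩
    exact ⟨⟨f, hfX, hfv⟩, fun hv ↦ hfH (hHc.closed (edgeInduce_inc.2 ⟨hfX, hfv⟩) hv)⟩
  have h4 := Set.ncard_le_ncard hsub (hVf.subset Set.sdiff_subset)
  have h5 := Set.ncard_sdiff_add_ncard_of_subset hHV hVf
  have h6 := Set.ncard_sdiff_add_ncard_of_subset hHX hXf
  omega

theorem exists_kCircuit_subset (hE : E(G).Finite) {k : ℕ} (hk : 1 ≤ k)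
    (hX : X ⊆ E(G)) (hkX : k ≤ (G.edgeInduce X).excess) :
    ∃ C ∈ G.kCircuits k, C ⊆ X := by
  induction h : X.ncard using Nat.strong_induction_on generalizing X with
  | _ n ih =>
    by_cases hXC : X ∈ G.kCircuits k
    · exact ⟨X, hXC, subset_rfl⟩
    obtain ⟨Y, hYX, hkY⟩ := exists_ssubset_of_notMem_kCircuits hE hk hX hkX hXC
    obtain ⟨C, hC, hCY⟩ := ih Y.ncard (h ▸ Set.ncard_lt_ncard hYX (hE.subset hX))
      (hYX.subset.trans hX) hkY rfl
    exact ⟨C, hC, hCY.trans hYX.subset⟩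

theorem no_kCircuit_iff (hE : E(G).Finite) {k : ℕ} (hk : 1 ≤ k) (hX : X ⊆ E(G)) :
    (∀ C ∈ G.kCircuits k, ¬ C ⊆ X) ↔ ∀ Y ⊆ X, (G.edgeInduce Y).excess < k := by
  constructor
  · intro h Y hY
    by_contra! hlt
    obtain ⟨C, hC, hCY⟩ := exists_kCircuit_subset hE hk (hY.trans hX) hlt
    exact h C hC (hCY.trans hY)
  · intro h C hC hCX
    have := h C hCX
    rw [hC.2.1] at this
    exact lt_irrefl _ this

theorem kCircuits_augment (hE : E(G).Finite) {k : ℕ} (hk : 1 ≤ k) {I J : Set β}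
    (hIE : I ⊆ E(G)) (hJE : J ⊆ E(G)) (hI : ∀ C ∈ G.kCircuits k, ¬ C ⊆ I)
    (hJ : ∀ C ∈ G.kCircuits k, ¬ C ⊆ J) (hIJ : I.ncard < J.ncard) :
    ∃ e ∈ J, e ∉ I ∧ ∀ C ∈ G.kCircuits k, ¬ C ⊆ insert e I := by
  rw [no_kCircuit_iff hE hk hIE] at hI
  rw [no_kCircuit_iff hE hk hJE] at hJ
  have hIf := hE.subset hIE
  have hJf := hE.subset hJE
  by_contra! hcon
  -- every `e ∈ J \ I` has both ends in a tight subset of `I`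
  have key : ∀ e ∈ J, e ∉ I → ∃ Y ⊆ I, (G.edgeInduce Y).excess = k - 1 ∧
      ∀ v, G.Inc e v → v ∈ V(G.edgeInduce Y) := by
    intro e heJ heI
    obtain ⟨C, hC, hCI⟩ := hcon e heJ heI
    have heC : e ∈ C := by
      by_contra heC
      have hCI' : C ⊆ I := fun f hf ↦ (hCI hf).resolve_left (fun h ↦ heC (h ▸ hf))
      have := hI C hCI'
      rw [hC.2.1] at this
      exact lt_irrefl _ this
    have hYI : C \ {e} ⊆ I := fun f hf ↦ (hCI hf.1).resolve_left hf.2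
    have hCf := hE.subset hC.1
    have hlt := hI _ hYI
    have hCk := hC.2.1
    rw [excess_edgeInduce hC.1] at hCk
    rw [excess_edgeInduce (hYI.trans hIE)] at hlt
    have h1 := Set.ncard_sdiff_singleton_add_one heC hCf
    have hsub := vertexSet_edgeInduce_mono (G := G) (Set.sdiff_subset : C \ {e} ⊆ C)
    have h2 := Set.ncard_le_ncard hsub (G.vertexSet_edgeInduce_finite hCf)
    have heq : V(G.edgeInduce (C \ {e})) = V(G.edgeInduce C) :=
      Set.eq_of_subset_of_ncard_le hsub (by omega) (G.vertexSet_edgeInduce_finite hCf)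
    refine ⟨C \ {e}, hYI, ?_, fun v hv ↦ heq ▸ ⟨e, heC, hv⟩⟩
    rw [excess_edgeInduce (hYI.trans hIE)]
    rw [heq] at hlt ⊢
    omega
  obtain ⟨e₀, he₀J, he₀I⟩ : ∃ e ∈ J, e ∉ I := by
    by_contra! h
    exact absurd (Set.ncard_le_ncard h hIf) (by omega)
  -- a largest tight subset of `I`
  obtain ⟨T, ⟨hTI, hTk⟩, hTmax⟩ :=
    (hIf.finite_subsets.subset (t := {Y | Y ⊆ I ∧ (G.edgeInduce Y).excess = k - 1})
      (fun Y hY ↦ hY.1)).exists_maximal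
      (by obtain ⟨Y, hY, hYk, -⟩ := key e₀ he₀J he₀I; exact ⟨Y, hY, hYk⟩)
  have hTall : ∀ Y ⊆ I, (G.edgeInduce Y).excess = k - 1 → Y ⊆ T := by
    intro Y hYI hYk
    have h1 := excess_edgeInduce_supermodular hE (hTI.trans hIE) (hYI.trans hIE)
    have h2 := hI _ (Set.union_subset hTI hYI)
    have h3 := hI _ ((Set.inter_subset_left : T ∩ Y ⊆ T).trans hTI)
    have h4 : (G.edgeInduce (T ∪ Y)).excess = k - 1 := by omega
    exact Set.subset_union_right.trans
      (hTmax (y := T ∪ Y) ⟨Set.union_subset hTI hYI, h4⟩ Set.subset_union_left)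
  have hK : (J \ I) ∪ (J ∩ T) ⊆ J := Set.union_subset Set.sdiff_subset Set.inter_subset_left
  have hKlt := hJ _ hK
  have hVsub : V(G.edgeInduce ((J \ I) ∪ (J ∩ T))) ⊆ V(G.edgeInduce T) := by
    rintro v ⟨e, he | he, hev⟩
    · obtain ⟨Y, hYI, hYk, hY⟩ := key e he.1 he.2
      exact vertexSet_edgeInduce_mono (hTall Y hYI hYk) (hY v hev)
    · exact ⟨e, he.2, hev⟩
  have hVle := Set.ncard_le_ncard hVsub (G.vertexSet_edgeInduce_finite (hIf.subset hTI))
  rw [excess_edgeInduce (hK.trans hJE)] at hKlt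
  rw [excess_edgeInduce (hTI.trans hIE)] at hTk
  have hdisj : Disjoint (J \ I) (J ∩ T) :=
    Set.disjoint_left.2 fun e he he' ↦ he.2 (hTI he'.2)
  rw [Set.ncard_union_eq hdisj (hJf.subset Set.sdiff_subset)
    (hJf.subset Set.inter_subset_left)] at hKlt
  have h1 := Set.ncard_inter_add_ncard_sdiff_eq_ncard T J (hIf.subset hTI)
  have h2 := Set.ncard_inter_add_ncard_sdiff_eq_ncard I J hIf
  have h3 := Set.ncard_inter_add_ncard_sdiff_eq_ncard J I hJf
  have h4 : (T \ J).ncard ≤ (I \ J).ncard :=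
    Set.ncard_le_ncard (Set.sdiff_subset_sdiff_left hTI) (hIf.subset Set.sdiff_subset)
  have h5 : (J ∩ T).ncard = (T ∩ J).ncard := by rw [Set.inter_comm]
  have h6 : (J ∩ I).ncard = (I ∩ J).ncard := by rw [Set.inter_comm]
  omega

/-- No proper subset of a member of `𝓒ₖ(G)` has excess at least `k`. -/
theorem excess_lt_of_ssubset_kCircuit (hE : E(G).Finite) {k : ℕ} {C : Set β}
    (hC : C ∈ G.kCircuits k) (hYC : Y ⊂ C) : (G.edgeInduce Y).excess < k := by
  classical
  obtain ⟨hCE, hCk, hd0, hd1, hcyc⟩ := hC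
  by_contra! hlt
  have hCf := hE.subset hCE
  have hVf := G.vertexSet_edgeInduce_finite hCf
  have hVmono := vertexSet_edgeInduce_mono (G := G) hYC.subset
  have hEC : E(G.edgeInduce C) = C := Set.inter_eq_right.2 hCE
  have hECf : E(G.edgeInduce C).Finite := hEC.symm ▸ hCf
  rw [excess_edgeInduce hCE] at hCk
  rw [excess_edgeInduce (hYC.subset.trans hCE)] at hlt
  set H := G.edgeInduce C with hH
  have hWf : (V(H) \ V(G.edgeInduce Y)).Finite := hVf.subset Set.sdiff_subset
  set W := hWf.toFinset with hW
  have hDf : (C \ Y).Finite := hCf.subset Set.sdiff_subset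
  have hmemW : ∀ v, v ∈ W ↔ v ∈ V(H) ∧ v ∉ V(G.edgeInduce Y) := fun v ↦ by simp [hW]
  have hsum : ∑ v ∈ W, H.degree v = ∑ e ∈ hDf.toFinset, H.endCount W e := by
    rw [sum_degree_eq hECf]
    symm
    refine Finset.sum_subset (fun e he ↦ ?_) (fun e he he' ↦ ?_)
    · simp only [Set.Finite.mem_toFinset] at he ⊢
      exact hEC.symm ▸ he.1
    · simp only [Set.Finite.mem_toFinset, hEC, Set.mem_sdiff, not_and, not_not] at he he'
      obtain ⟨x, y, hxy⟩ := H.exists_isLink_of_mem_edgeSet (hEC.symm ▸ he)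
      have hx : x ∉ W :=
        fun h ↦ ((hmemW x).1 h).2 ⟨e, he' he, (edgeInduce_inc.1 hxy.inc_left).2⟩
      have hy : y ∉ W :=
        fun h ↦ ((hmemW y).1 h).2 ⟨e, he' he, (edgeInduce_inc.1 hxy.inc_right).2⟩
      rw [endCount_eq hxy, if_neg hx, if_neg hy]
      exact Nat.add_zero 0
  have hdeg : ∀ v ∈ W, 2 ≤ H.degree v := by
    intro v hv
    have h0 := hd0 v ((hmemW v).1 hv).1
    have h1 := hd1 v ((hmemW v).1 hv).1
    omega
  have hend : ∀ e ∈ hDf.toFinset, H.endCount W e ≤ 2 := by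
    intro e he
    simp only [Set.Finite.mem_toFinset] at he
    obtain ⟨x, y, hxy⟩ := H.exists_isLink_of_mem_edgeSet (hEC.symm ▸ he.1)
    rw [endCount_eq hxy]
    split_ifs <;> omega
  have hle1 := Finset.sum_le_sum hdeg
  have hle2 := Finset.sum_le_sum hend
  have hWc : W.card = (V(H) \ V(G.edgeInduce Y)).ncard :=
    (Set.ncard_eq_toFinset_card _ hWf).symm
  have hDc : hDf.toFinset.card = (C \ Y).ncard := (Set.ncard_eq_toFinset_card _ hDf).symm
  have h5 := Set.ncard_sdiff_add_ncard_of_subset hVmono hVf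
  have h6 := Set.ncard_sdiff_add_ncard_of_subset hYC.subset hCf
  have hWD : hDf.toFinset.card ≤ W.card := by omega
  have hc1 : ∑ v ∈ W, 2 = 2 * W.card := by simp [mul_comm]
  have hc2 : ∑ e ∈ hDf.toFinset, 2 = 2 * hDf.toFinset.card := by simp [mul_comm]
  have hdeg2 := (Finset.sum_eq_sum_iff_of_le hdeg).1 (by omega)
  have hend2 := (Finset.sum_eq_sum_iff_of_le hend).1 (by omega)
  have hstep : ∀ e x y, H.IsLink e x y → e ∉ Y → x ∈ W ∧ y ∈ W := by
    intro e x y hxy heY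
    have h := hend2 e (by simpa using ⟨hEC ▸ hxy.edge_mem, heY⟩)
    rw [endCount_eq hxy] at h
    split_ifs at h with h1 h2 h2
    · exact ⟨h1, h2⟩
    all_goals omega
  obtain ⟨e, heC, heY⟩ := Set.exists_of_ssubset hYC
  obtain ⟨x, y, hxy⟩ := H.exists_isLink_of_mem_edgeSet (hEC.symm ▸ heC)
  have hR : ∀ z, Relation.ReflTransGen H.Adj x z → z ∈ W := by
    intro z hz
    induction hz with
    | refl => exact (hstep e x y hxy heY).1
    | tail _ hab ih =>
      obtain ⟨f, hf⟩ := hab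
      refine (hstep f _ _ hf fun hfY ↦ ?_).2
      exact ((hmemW _).1 ih).2 ⟨f, hfY, (edgeInduce_inc.1 hf.inc_left).2⟩
  set R : Set α := {z | Relation.ReflTransGen H.Adj x z} with hRdef
  have hRV : R ⊆ V(H) := fun z hz ↦ ((hmemW z).1 (hR z hz)).1
  have hKc : H.induce R ≤c H := by
    refine IsClosedSubgraph.mk' (induce_le hRV) fun f v hfv hv ↦ ?_
    obtain ⟨w, hw⟩ := hfv
    exact ⟨v, w, hw, hv, Relation.ReflTransGen.tail hv ⟨f, hw⟩⟩
  have hreach : ∀ z, Relation.ReflTransGen H.Adj x z →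
      Relation.ReflTransGen (H.induce R).Adj x z := by
    intro z hz
    induction hz with
    | refl => exact Relation.ReflTransGen.refl
    | tail ha hab ih =>
      obtain ⟨f, hf⟩ := hab
      exact ih.tail ⟨f, hf, ha, ha.tail ⟨f, hf⟩⟩
  refine hcyc ⟨H.induce R, hKc, ⟨⟨x, Relation.ReflTransGen.refl⟩, fun a ha b hb ↦ ?_⟩,
    fun v hv ↦ ?_⟩
  · exact (Std.Symm.symm _ _ (hreach a ha)).trans
      (hreach b hb)
  · have h1 : (H.induce R).incidenceSet v = H.incidenceSet v :=
      Set.ext fun f ↦ hKc.inc_congr hv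
    have h2 : (H.induce R).loopSet v = H.loopSet v :=
      Set.ext fun f ↦ hKc.isLink_congr hv
    rw [degree, h1, h2]
    exact (hdeg2 v (hR v hv)).symm

end Aux

/-! ### The `k`-circular matroid -/

/-- The `k`-circular matroid `Mₖ(G)` of a graph `G` with finitely many edges, `k ≥ 1`: the matroid
on `E(G)` whose independent sets are the edge sets that contain no member of `𝓒ₖ(G)`. -/
def kCircularMatroid (G : Graph α β) (hE : E(G).Finite) (k : ℕ) (hk : 1 ≤ k) : Matroid β :=
  (IndepMatroid.ofFinite hE (fun I ↦ I ⊆ E(G) ∧ ∀ C ∈ G.kCircuits k, ¬ C ⊆ I)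
    ⟨Set.empty_subset _, by
      rw [no_kCircuit_iff hE hk (Set.empty_subset _)]
      intro Y hY
      obtain rfl := Set.subset_empty_iff.1 hY
      rw [excess_edgeInduce (Set.empty_subset _), Set.ncard_empty]
      omega⟩
    (fun _ _ hJ hIJ ↦ ⟨hIJ.trans hJ.1, fun C hC hCI ↦ hJ.2 C hC (hCI.trans hIJ)⟩)
    (fun I J hI hJ hIJ ↦ by
      obtain ⟨e, heJ, heI, he⟩ := kCircuits_augment hE hk hI.1 hJ.1 hI.2 hJ.2 hIJ
      exact ⟨e, heJ, heI, Set.insert_subset (hJ.1 heJ) hI.1, he⟩)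
    (fun _ hI ↦ hI.1)).matroid

theorem kCircularMatroid_indep_iff (G : Graph α β) (hE : E(G).Finite) (k : ℕ) (hk : 1 ≤ k)
    (I : Set β) : (G.kCircularMatroid hE k hk).Indep I ↔
      I ⊆ E(G) ∧ ∀ C ∈ G.kCircuits k, ¬ C ⊆ I := by
  simp [kCircularMatroid]

/-- The circuits of `Mₖ(G)` are the members of `𝓒ₖ(G)`. -/
theorem kCircularMatroid_isCircuit_iff (G : Graph α β) (hE : E(G).Finite) (k : ℕ) (hk : 1 ≤ k)
    (C : Set β) : (G.kCircularMatroid hE k hk).IsCircuit C ↔ C ∈ G.kCircuits k := by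
  have hdep : ∀ X, (G.kCircularMatroid hE k hk).Dep X ↔
      X ⊆ E(G) ∧ ∃ C ∈ G.kCircuits k, C ⊆ X := by
    intro X
    have hgr : (G.kCircularMatroid hE k hk).E = E(G) := by simp [kCircularMatroid]
    rw [Matroid.Dep, kCircularMatroid_indep_iff, hgr]
    grind
  constructor
  · intro h
    obtain ⟨hCE, D, hD, hDC⟩ := (hdep C).1 h.dep
    have := h.eq_of_dep_subset ((hdep D).2 ⟨hD.1, D, hD, subset_rfl⟩) hDC
    exact this ▸ hD
  · intro hC
    refine ⟨(hdep C).2 ⟨hC.1, C, hC, subset_rfl⟩, fun X hX hXC ↦ ?_⟩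
    obtain ⟨-, D, hD, hDX⟩ := (hdep X).1 hX
    by_contra hne
    have hlt := excess_lt_of_ssubset_kCircuit hE hC
      (⟨hDX.trans hXC, fun h ↦ hne (h.trans hDX)⟩ : D ⊂ C)
    rw [hD.2.1] at hlt
    exact lt_irrefl _ hlt

/-- The corank `ρ*ₖ(G)`: the rank of the dual of `Mₖ(G)`. -/
noncomputable def kCorank (G : Graph α β) (hE : E(G).Finite) (k : ℕ) (hk : 1 ≤ k) : ℕ∞ :=
  (G.kCircularMatroid hE k hk)✶.eRank

/-! ### Stars, connectivity and strong isomorphism -/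

/-- The size `s(v, G)` of the vertex star `S(v, G)`, the set of edges incident to `v`. -/
noncomputable def starSize (G : Graph α β) (v : α) : ℕ∞ := (G.incidenceSet v).encard

/-- The set `𝓢(G)` of the vertex stars of `G`. -/
def starFamily (G : Graph α β) : Set (Set β) := {S | ∃ v ∈ V(G), S = G.incidenceSet v}

/-- `v` is `k`-small in `G`. -/
def IsKSmall (G : Graph α β) (hE : E(G).Finite) (k : ℕ) (hk : 1 ≤ k) (v : α) : Prop :=
  G.starSize v < G.kCorank hE k hk + 1

/-- `v` is `k`-tight in `G`. -/
def IsKTight (G : Graph α β) (hE : E(G).Finite) (k : ℕ) (hk : 1 ≤ k) (v : α) : Prop :=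
  G.starSize v = G.kCorank hE k hk + 1

/-- `G` is `3`-connected: it has no loops and at least four vertices, and the deletion of any set of
at most two vertices leaves a connected graph. Parallel edges are allowed. -/
def IsThreeConnected (G : Graph α β) : Prop :=
  G.Loopless ∧ 4 ≤ V(G).encard ∧
    ∀ X ⊆ V(G), X.encard ≤ 2 → (G.deleteVerts X).Connected

/-- `G` and `G'` have the same edges, and some bijection between their vertex sets
carries the ends of each edge in `G` to its ends in `G'`. -/
def StronglyIsomorphic (G : Graph α β) (G' : Graph α' β) : Prop :=
  E(G) = E(G') ∧ ∃ ν : V(G) ≃ V(G'), ∀ (e : β) (x y : V(G)),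
    G.IsLink e x y ↔ G'.IsLink e (ν x) (ν y)

end Graph

/-!
In `M_k(G)` the nullity of an edge set `X` is the maximum of `0` and of `ΔG⟨Y⟩ - (k - 1)` over
`Y ⊆ X`, so `M_k(G)` determines the maximal excess of the subsets of `X` as soon as it is at least
`k`. If `G` is `3`-connected, then `G` and each `G - x` have strictly larger excess than their
nonempty proper edge subsets, hence these excesses can be read off from the matroid when they are
at least `k`. The excess of `G` gives `|V(G')| = |V(G)|`. When `x` is `k`-small, the excess of
`G - x` is at least `k`, and it shows that some vertex `v` of `G'` meets no edge of `G - x`; its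
star is all of `S(x, G)`, for an edge of `S(x, G)` avoiding `v` could be added to `E(G - x)` and
would raise the excess in `G'`, but not in `G`. For the tight vertex `t` the excess of `G - t` may
be only `k - 1`. There the stars already found leave out one vertex of `G'`, and each edge of
`G - t` already has its two ends elsewhere, so that the same argument applies to this vertex.
-/

namespace KCircular

open Graph

variable {α α' β : Type*} {G H : Graph α β} {G' : Graph α' β} {X Y I : Set β} {S : Set α}
  {x y v : α} {e : β} {k : ℕ}

/-! ### Excess and nullity -/

theorem excess_edgeInduce_empty (G : Graph α β) : (G.edgeInduce ∅).excess = 0 := by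
  simp [excess, edgeInduce]

theorem excess_edgeInduce_le_add_ncard_sdiff (hE : E(G).Finite) (hY : Y ⊆ E(G)) (hIY : I ⊆ Y) :
    (G.edgeInduce Y).excess ≤ (G.edgeInduce I).excess + (Y \ I).ncard := by
  have hYfin := hE.subset hY
  have hVcard := Set.ncard_le_ncard (vertexSet_edgeInduce_mono (G := G) hIY)
    (G.vertexSet_edgeInduce_finite hYfin)
  have hYcard := Set.ncard_sdiff_add_ncard_of_subset hIY hYfin
  rw [excess_edgeInduce hY, excess_edgeInduce (hIY.trans hY)]
  omega

theorem exists_mem_forall_excess_lt (hE : E(G).Finite) (hX : X ⊆ E(G)) {m : ℤ} (hm : 0 < m)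
    (hle : ∀ Y ⊆ X, (G.edgeInduce Y).excess ≤ m) (hmax : ∃ Y ⊆ X, (G.edgeInduce Y).excess = m) :
    ∃ e ∈ X, ∀ Y ⊆ X \ {e}, (G.edgeInduce Y).excess < m := by
  obtain ⟨Z, ⟨hZX, hZm⟩, hmin⟩ := ((hE.subset hX).finite_subsets.subset
    (t := {Z | Z ⊆ X ∧ (G.edgeInduce Z).excess = m}) fun Z hZ ↦ hZ.1).exists_minimal hmax
  obtain ⟨e, he⟩ : Z.Nonempty := by
    rw [Set.nonempty_iff_ne_empty]
    rintro rfl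
    exact hm.ne ((excess_edgeInduce_empty G).symm.trans hZm)
  refine ⟨e, hZX he, fun Y hYe ↦ ?_⟩
  have hYX := hYe.trans Set.sdiff_subset
  refine (hle Y hYX).lt_of_ne fun hYm ↦ ?_
  -- By supermodularity `Z ∩ Y` also attains the maximum, although it misses `e ∈ Z`.
  have hsuper := excess_edgeInduce_supermodular hE (hZX.trans hX) (hYX.trans hX)
  have hunion := hle _ (Set.union_subset hZX hYX)
  have hinter := hle _ (Set.inter_subset_left.trans hZX : Z ∩ Y ⊆ X)
  have hZY : Z ⊆ Z ∩ Y :=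
    hmin ⟨Set.inter_subset_left.trans hZX, by omega⟩ Set.inter_subset_left
  exact (hYe (hZY he).2).2 rfl

theorem kCircularMatroid_ground (hE : E(G).Finite) (hk : 1 ≤ k) :
    (G.kCircularMatroid hE k hk).E = E(G) := by
  simp [kCircularMatroid]

theorem indep_iff_forall_excess_lt (hE : E(G).Finite) (hk : 1 ≤ k) (hX : X ⊆ E(G)) :
    (G.kCircularMatroid hE k hk).Indep X ↔ ∀ Y ⊆ X, (G.edgeInduce Y).excess < k := by
  rw [kCircularMatroid_indep_iff, no_kCircuit_iff hE hk hX, and_iff_right hX]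

theorem excess_le_of_encard_le_eRk_add (hE : E(G).Finite) (hk : 1 ≤ k) (hX : X ⊆ E(G)) {n : ℕ}
    (hn : X.encard ≤ (G.kCircularMatroid hE k hk).eRk X + n) (hY : Y ⊆ X) :
    (G.edgeInduce Y).excess ≤ k - 1 + n := by
  have hXfin := hE.subset hX
  obtain ⟨I, hI⟩ := (G.kCircularMatroid hE k hk).exists_isBasis X
    (by rwa [kCircularMatroid_ground])
  have hIX := hI.subset
  have hcard : X.ncard ≤ I.ncard + n := by
    rw [← hI.encard_eq_eRk, ← hXfin.cast_ncard_eq, ← (hXfin.subset hIX).cast_ncard_eq] at hn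
    exact_mod_cast hn
  have hlt := (indep_iff_forall_excess_lt hE hk (hIX.trans hX)).1 hI.indep _
    (Set.inter_subset_right : Y ∩ I ⊆ I)
  have hadd := excess_edgeInduce_le_add_ncard_sdiff hE (hY.trans hX)
    (Set.inter_subset_left : Y ∩ I ⊆ Y)
  rw [Set.sdiff_self_inter] at hadd
  have hdiff := Set.ncard_le_ncard (Set.sdiff_subset_sdiff_left hY : Y \ I ⊆ X \ I)
    (hXfin.subset Set.sdiff_subset)
  have hXI := Set.ncard_sdiff_add_ncard_of_subset hIX hXfin
  omega

theorem encard_le_eRk_add_of_forall_excess_le (hE : E(G).Finite) (hk : 1 ≤ k) (hX : X ⊆ E(G))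
    {n : ℕ} (hle : ∀ Y ⊆ X, (G.edgeInduce Y).excess ≤ k - 1 + n) :
    X.encard ≤ (G.kCircularMatroid hE k hk).eRk X + n := by
  induction n generalizing X with
  | zero =>
    have hindep := (indep_iff_forall_excess_lt hE hk hX).2 fun Y hY ↦ by
      have := hle Y hY
      omega
    simp [hindep.eRk_eq_encard]
  | succ n ih =>
    push_cast at hle ⊢
    rw [← add_assoc]
    by_cases hmax : ∃ Y ⊆ X, (G.edgeInduce Y).excess = k - 1 + (n + 1)
    · obtain ⟨e, he, hlt⟩ := exists_mem_forall_excess_lt hE hX (by omega) hle hmax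
      have hXe : X \ {e} ⊆ X := Set.sdiff_subset
      have hn := ih (hXe.trans hX) fun Y hY ↦ by
        have := hlt Y hY
        omega
      rw [← Set.encard_sdiff_singleton_add_one he]
      gcongr
      exact hn.trans (by gcongr; exact Matroid.eRk_mono _ hXe)
    · push Not at hmax
      refine (ih hX fun Y hY ↦ ?_).trans le_self_add
      have := hle Y hY
      have := hmax Y hY
      omega

theorem encard_le_eRk_add_iff (hE : E(G).Finite) (hk : 1 ≤ k) (hX : X ⊆ E(G)) (n : ℕ) :
    X.encard ≤ (G.kCircularMatroid hE k hk).eRk X + n ↔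
      ∀ Y ⊆ X, (G.edgeInduce Y).excess ≤ k - 1 + n :=
  ⟨fun hn _ ↦ excess_le_of_encard_le_eRk_add hE hk hX hn,
    encard_le_eRk_add_of_forall_excess_le hE hk hX⟩

theorem kCorank_le_iff (hE : E(G).Finite) (hk : 1 ≤ k) (n : ℕ) :
    G.kCorank hE k hk ≤ n ↔ ∀ Y ⊆ E(G), (G.edgeInduce Y).excess ≤ k - 1 + n := by
  have hground := kCircularMatroid_ground hE hk
  have hsum := (G.kCircularMatroid hE k hk).eRank_add_eRank_dual
  rw [hground] at hsum
  have hrank : (G.kCircularMatroid hE k hk).eRank ≠ ⊤ :=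
    (le_self_add.trans_lt (hsum.trans_lt hE.encard_lt_top)).ne
  rw [← encard_le_eRk_add_iff hE hk subset_rfl, ← hsum, ← hground, Matroid.eRk_ground,
    ENat.add_le_add_iff_left hrank, kCorank]

theorem edgeSet_eq_of_kCircularMatroid_eq {hE : E(G).Finite} {hE' : E(G').Finite} {hk : 1 ≤ k}
    (hM : G'.kCircularMatroid hE' k hk = G.kCircularMatroid hE k hk) : E(G') = E(G) := by
  rw [← kCircularMatroid_ground hE' hk, hM, kCircularMatroid_ground]

theorem excess_le_of_kCircularMatroid_eq {hE : E(G).Finite} {hE' : E(G').Finite} {hk : 1 ≤ k}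
    (hM : G'.kCircularMatroid hE' k hk = G.kCircularMatroid hE k hk) (hX : X ⊆ E(G)) {m : ℤ}
    (hm : k - 1 ≤ m) (hle : ∀ Y ⊆ X, (G.edgeInduce Y).excess ≤ m) :
    (G'.edgeInduce X).excess ≤ m := by
  obtain ⟨n, rfl⟩ := Int.le.dest hm
  have hX' : X ⊆ E(G') := edgeSet_eq_of_kCircularMatroid_eq hM ▸ hX
  rw [← encard_le_eRk_add_iff hE hk hX, ← hM, encard_le_eRk_add_iff hE' hk hX'] at hle
  exact hle X subset_rfl

theorem excess_eq_of_kCircularMatroid_eq {hE : E(G).Finite} {hE' : E(G').Finite} {hk : 1 ≤ k}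
    (hM : G'.kCircularMatroid hE' k hk = G.kCircularMatroid hE k hk) (hX : X ⊆ E(G))
    (hkX : k ≤ (G.edgeInduce X).excess)
    (hlt : ∀ Y, Y ⊂ X → (G.edgeInduce Y).excess < (G.edgeInduce X).excess) :
    (G'.edgeInduce X).excess = (G.edgeInduce X).excess := by
  have hle : ∀ Y ⊆ X, (G.edgeInduce Y).excess ≤ (G.edgeInduce X).excess := fun Y hY ↦
    hY.eq_or_ssubset.elim (fun h ↦ h ▸ le_rfl) fun h ↦ (hlt Y h).le
  refine (excess_le_of_kCircularMatroid_eq hM hX (by omega) hle).antisymm ?_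
  by_contra! hX'
  have hle' : ∀ Y ⊆ X, (G'.edgeInduce Y).excess ≤ (G.edgeInduce X).excess - 1 := by
    intro Y hY
    obtain rfl | hYX := hY.eq_or_ssubset
    · omega
    refine excess_le_of_kCircularMatroid_eq hM (hY.trans hX) (by omega) fun Z hZ ↦ ?_
    have := hlt Z (hZ.trans_ssubset hYX)
    omega
  have := excess_le_of_kCircularMatroid_eq hM.symm
    (edgeSet_eq_of_kCircularMatroid_eq hM ▸ hX) (by omega) hle'
  omega

/-! ### Connected graphs without leaves -/

/-- `G` is connected and all its degrees are at least two. In such a graph every nonempty proper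
subset of the edges has smaller excess than `G`; if `G` is `3`-connected, then this notion applies
both to `G` and to each of the graphs `G - x`. -/
def IsConnectedLeafless (G : Graph α β) : Prop :=
  G.Connected ∧ ∀ v ∈ V(G), 2 ≤ G.degree v

theorem edgeInduce_eq_of_le (hHG : H ≤ G) (hY : Y ⊆ E(H)) : H.edgeInduce Y = G.edgeInduce Y := by
  have hinc : ∀ e ∈ Y, ∀ v, H.Inc e v ↔ G.Inc e v := fun e he v ↦ hHG.inc_congr (hY he)
  refine Graph.ext_inc ?_ fun e v ↦ ?_
  · ext v
    exact exists_congr fun e ↦ and_congr_right fun he ↦ hinc e he v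
  · simp only [edgeInduce_inc]
    exact and_congr_right fun he ↦ hinc e he v

theorem edgeInduce_edgeSet (hG : ∀ v ∈ V(G), ∃ e, G.Inc e v) : G.edgeInduce E(G) = G := by
  refine Graph.ext_inc ?_ fun e v ↦ ?_
  · ext v
    exact ⟨fun ⟨e, _, hev⟩ ↦ hev.vertex_mem, fun hv ↦
      (hG v hv).imp fun e hev ↦ ⟨hev.edge_mem, hev⟩⟩
  · rw [edgeInduce_inc, and_iff_right_of_imp Inc.edge_mem]

theorem finite_vertexSet (hE : E(G).Finite) (hG : ∀ v ∈ V(G), ∃ e, G.Inc e v) : V(G).Finite := by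
  rw [← edgeInduce_edgeSet hG]
  exact G.vertexSet_edgeInduce_finite hE

theorem degree_le_of_le (hE : E(G).Finite) (hHG : H ≤ G) (v : α) : H.degree v ≤ G.degree v := by
  refine Nat.add_le_add (Set.ncard_le_ncard (fun e he ↦ ?_) (hE.subset fun e he ↦ ?_))
    (Set.ncard_le_ncard (fun e he ↦ ?_) (hE.subset fun e he ↦ ?_))
  · exact Inc.mono hHG he
  · exact Inc.edge_mem he
  · exact IsLink.mono hHG he
  · exact IsLink.edge_mem he

theorem exists_isLink_of_connected (hG : G.Connected) (hx : x ∈ V(G)) (hxS : x ∈ S)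
    (hy : y ∈ V(G)) (hyS : y ∉ S) : ∃ e a b, G.IsLink e a b ∧ a ∈ S ∧ b ∉ S := by
  by_contra! hclosed
  have hreach : ∀ z, Relation.ReflTransGen G.Adj x z → z ∈ S := fun z hz ↦ by
    induction hz with
    | refl => exact hxS
    | tail _ hadj ha =>
      obtain ⟨e, he⟩ := hadj
      exact hclosed e _ _ he ha
  exact hyS (hreach y (hG.2 x hx y hy))

theorem excess_edgeInduce_le_insert {a b : α} (hE : E(G).Finite) (hY : Y ⊆ E(G)) (heY : e ∉ Y)
    (he : G.IsLink e a b) (ha : a ∈ V(G.edgeInduce Y)) :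
    (G.edgeInduce Y).excess ≤ (G.edgeInduce (insert e Y)).excess := by
  have hYfin := hE.subset hY
  have hVfin := G.vertexSet_edgeInduce_finite hYfin
  have hVsub : V(G.edgeInduce (insert e Y)) ⊆ insert b V(G.edgeInduce Y) := by
    rintro v ⟨f, rfl | hf, hv⟩
    · obtain rfl | rfl := hv.eq_or_eq_of_isLink he
      exacts [.inr ha, .inl rfl]
    · exact .inr ⟨f, hf, hv⟩
  have hVcard := (Set.ncard_le_ncard hVsub (hVfin.insert b)).trans (Set.ncard_insert_le _ _)
  rw [excess_edgeInduce hY, excess_edgeInduce (Set.insert_subset he.edge_mem hY),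
    Set.ncard_insert_of_notMem heY hYfin]
  omega

theorem excess_edgeInduce_insert_le (hE : E(G).Finite) (hY : Y ⊆ E(G)) (he : G.Inc e v)
    (hv : v ∉ V(G.edgeInduce Y)) :
    (G.edgeInduce (insert e Y)).excess ≤ (G.edgeInduce Y).excess := by
  have heY : insert e Y ⊆ E(G) := Set.insert_subset he.edge_mem hY
  have hVss : V(G.edgeInduce Y) ⊂ V(G.edgeInduce (insert e Y)) :=
    (vertexSet_edgeInduce_mono (Set.subset_insert e Y)).ssubset_of_mem_notMem
      ⟨e, Set.mem_insert e Y, he⟩ hv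
  have hVcard := Set.ncard_lt_ncard hVss (G.vertexSet_edgeInduce_finite (hE.subset heY))
  have hYcard := Set.ncard_insert_le e Y
  rw [excess_edgeInduce hY, excess_edgeInduce heY]
  omega

namespace IsConnectedLeafless

theorem exists_inc (hG : IsConnectedLeafless G) : ∀ v ∈ V(G), ∃ e, G.Inc e v := by
  intro v hv
  by_contra! hnot
  have hinc : G.incidenceSet v = ∅ := Set.eq_empty_of_forall_notMem hnot
  have hloop : G.loopSet v = ∅ := Set.eq_empty_of_forall_notMem fun e he ↦ hnot e (IsLoopAt.inc he)
  have := hG.2 v hv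
  simp [degree, hinc, hloop] at this

theorem two_le_ncard_incidenceSet [G.Loopless] (hG : IsConnectedLeafless G) (hv : v ∈ V(G)) :
    2 ≤ (G.incidenceSet v).ncard := by
  have hloop : G.loopSet v = ∅ := Set.eq_empty_of_forall_notMem fun e ↦ not_isLoopAt G e v
  simpa [degree, hloop] using hG.2 v hv

theorem exists_ne_inc {a b : α} (hG : IsConnectedLeafless G) (he : G.IsLink e a b) (hab : a ≠ b) :
    ∃ f ≠ e, G.Inc f b := by
  by_contra! hnot
  have hinc : G.incidenceSet b ⊆ {e} := fun f hf ↦ by_contra fun hne ↦ hnot f hne hf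
  have hloop : G.loopSet b = ∅ := Set.eq_empty_of_forall_notMem fun f hf ↦ by
    obtain rfl : f = e := hinc (IsLoopAt.inc hf)
    exact hab (he.symm.right_unique hf)
  have hcard := Set.ncard_le_ncard hinc
  have hdeg := hG.2 b he.right_mem
  rw [degree, hloop, Set.ncard_empty] at hdeg
  rw [Set.ncard_singleton] at hcard
  omega

theorem excess_lt_of_ssubset (hG : IsConnectedLeafless G) (hE : E(G).Finite) (hY : Y ⊂ E(G))
    (hne : Y.Nonempty) : (G.edgeInduce Y).excess < G.excess := by
  induction hn : (E(G) \ Y).ncard generalizing Y with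
  | zero => exact absurd (Set.sdiff_eq_empty.1 ((Set.ncard_eq_zero (hE.sdiff)).1 hn)) hY.2
  | succ n ih =>
    obtain ⟨f, hf⟩ := hne
    obtain ⟨a₀, _, hf₀⟩ := G.exists_isLink_of_mem_edgeSet (hY.subset hf)
    by_cases hV : V(G) ⊆ V(G.edgeInduce Y)
    · have hVcard := Set.ncard_le_ncard hV (G.vertexSet_edgeInduce_finite (hE.subset hY.subset))
      have hEcard := Set.ncard_lt_ncard hY hE
      rw [excess_edgeInduce hY.subset, excess]
      omega
    obtain ⟨b₀, hb₀, hb₀Y⟩ := Set.not_subset.1 hV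
    obtain ⟨e, a, b, he, ha, hb⟩ :=
      exists_isLink_of_connected (S := V(G.edgeInduce Y)) hG.1 hf₀.left_mem
        ⟨f, hf, hf₀.inc_left⟩ hb₀ hb₀Y
    have heY : e ∉ Y := fun heY ↦ hb ⟨e, heY, he.inc_right⟩
    -- `b` has a second edge `g`, so adding `e` to `Y` still leaves a proper subset of `E(G)`.
    obtain ⟨g, hge, hgb⟩ := hG.exists_ne_inc he (fun hab ↦ hb (hab ▸ ha))
    have hgY : g ∉ insert e Y := fun hg ↦ hb ⟨g, hg.resolve_left hge, hgb⟩
    refine (excess_edgeInduce_le_insert hE hY.subset heY he ha).trans_lt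
      (ih ((Set.insert_subset he.edge_mem hY.subset).ssubset_of_mem_notMem hgb.edge_mem hgY)
        (Set.insert_nonempty e Y) ?_)
    have heEY : e ∈ E(G) \ Y := ⟨he.edge_mem, heY⟩
    have := Set.ncard_sdiff_singleton_add_one heEY hE.sdiff
    rw [Set.sdiff_sdiff, Set.union_singleton] at this
    omega

theorem excess_le (hG : IsConnectedLeafless G) (hE : E(G).Finite) (hY : Y ⊆ E(G)) :
    (G.edgeInduce Y).excess ≤ max 0 G.excess := by
  obtain rfl | hne := Y.eq_empty_or_nonempty
  · exact (excess_edgeInduce_empty G).trans_le (le_max_left _ _)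
  refine le_max_of_le_right ?_
  obtain rfl | hss := hY.eq_or_ssubset
  · rw [edgeInduce_edgeSet hG.exists_inc]
  · exact (hG.excess_lt_of_ssubset hE hss hne).le

theorem excess_lt_of_ssubset_of_pos (hG : IsConnectedLeafless G) (hE : E(G).Finite)
    (hpos : 0 < G.excess) (hY : Y ⊂ E(G)) : (G.edgeInduce Y).excess < G.excess := by
  obtain rfl | hne := Y.eq_empty_or_nonempty
  · rwa [excess_edgeInduce_empty]
  · exact hG.excess_lt_of_ssubset hE hY hne

theorem lt_kCorank_iff (hG : IsConnectedLeafless G) (hE : E(G).Finite) (hk : 1 ≤ k) (n : ℕ) :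
    n < G.kCorank hE k hk ↔ k + n ≤ G.excess := by
  rw [← not_le, kCorank_le_iff, not_iff_comm]
  constructor
  · intro hlt Y hY
    have := hG.excess_le hE hY
    omega
  · intro hle
    have := hle E(G) subset_rfl
    rw [edgeInduce_edgeSet hG.exists_inc] at this
    omega

end IsConnectedLeafless

theorem isConnectedLeafless_of_forall_deleteVerts [G.Loopless] (hE : E(G).Finite)
    (hne : V(G).Nonempty) (hG : ∀ x ∈ V(G), IsConnectedLeafless (G.deleteVerts {x})) :
    IsConnectedLeafless G := by
  have hle : ∀ x, G.deleteVerts {x} ≤ G := fun x ↦ deleteVerts_le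
  refine ⟨⟨hne, fun x hx y hy ↦ ?_⟩, fun v hv ↦ ?_⟩
  · obtain rfl | hxy := eq_or_ne x y
    · exact .refl
    obtain ⟨e, z, he⟩ := (hG x hx).exists_inc y ⟨hy, hxy.symm⟩
    obtain ⟨hez, -, hzx⟩ := (deleteVerts_isLink G {x}).1 he
    exact Relation.ReflTransGen.mono (fun a b ↦ Adj.mono (hle z)) x y
      ((hG z hez.right_mem).1.2 x ⟨hx, Ne.symm hzx⟩ y ⟨hy, hez.ne⟩)
  · obtain ⟨w, hw, hwv⟩ := (hG v hv).1.1
    exact ((hG w hw).2 v ⟨hv, Ne.symm hwv⟩).trans (degree_le_of_le hE (hle w) v)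

theorem exists_isLink_notMem_of_isThreeConnected (hG : G.IsThreeConnected) (hS : S ⊆ V(G))
    (hScard : S.encard ≤ 2) (hx : x ∈ V(G)) (hxS : x ∉ S) : ∃ e y, G.IsLink e x y ∧ y ∉ S := by
  have hlt : (insert x S).encard < V(G).encard := calc
    (insert x S).encard ≤ S.encard + 1 := Set.encard_insert_le S x
    _ ≤ 2 + 1 := by gcongr
    _ < 4 := by norm_num
    _ ≤ V(G).encard := hG.2.1
  obtain ⟨z, hz, hzxS⟩ := Set.not_subset.1 (mt Set.encard_le_encard hlt.not_ge)
  rw [Set.mem_insert_iff, not_or] at hzxS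
  obtain ⟨e, a, b, he, rfl, -⟩ := exists_isLink_of_connected (S := {x}) (hG.2.2 S hS hScard)
    ⟨hx, hxS⟩ rfl ⟨hz, hzxS.2⟩ hzxS.1
  obtain ⟨he, -, hbS⟩ := (deleteVerts_isLink G S).1 he
  exact ⟨e, b, he, hbS⟩

theorem isConnectedLeafless_deleteVerts_of_isThreeConnected (hG : G.IsThreeConnected)
    (hE : E(G).Finite) (hx : x ∈ V(G)) : IsConnectedLeafless (G.deleteVerts {x}) := by
  have := hG.1
  have hle : G.deleteVerts {x} ≤ G := deleteVerts_le
  refine ⟨hG.2.2 {x} (by simpa) (by simp), fun v ⟨hv, hvx⟩ ↦ ?_⟩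
  obtain ⟨e, y, he, hyx⟩ := exists_isLink_notMem_of_isThreeConnected hG (S := {x}) (by simpa)
    (by simp) hv hvx
  obtain ⟨f, z, hf, hz⟩ := exists_isLink_notMem_of_isThreeConnected hG (S := {x, y})
    (Set.pair_subset hx he.right_mem) (Set.encard_pair (Ne.symm hyx)).le hv
    (by rintro (rfl | rfl); exacts [hvx rfl, he.ne rfl])
  rw [Set.mem_insert_iff, not_or] at hz
  have hef : e ≠ f := by
    rintro rfl
    exact hz.2 (hf.right_unique he)
  have hcard : 1 < ((G.deleteVerts {x}).incidenceSet v).ncard :=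
    (Set.one_lt_ncard (hE.subset fun g hg ↦ (Inc.mono hle hg).edge_mem)).2
      ⟨e, ⟨y, (deleteVerts_isLink G {x}).2 ⟨he, hvx, hyx⟩⟩,
        f, ⟨z, (deleteVerts_isLink G {x}).2 ⟨hf, hvx, hz.1⟩⟩, hef⟩
  exact hcard.trans_le le_self_add

/-! ### Vertex stars -/

theorem edgeSet_deleteVerts_singleton (G : Graph α β) (x : α) :
    E(G.deleteVerts {x}) = E(G) \ G.incidenceSet x := by
  ext e
  rw [edgeSet_deleteVerts]
  constructor
  · rintro ⟨a, b, he, ha, hb⟩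
    exact ⟨he.edge_mem, fun hx ↦ (hx.eq_or_eq_of_isLink he).elim (ha ·.symm) (hb ·.symm)⟩
  · rintro ⟨he, hx⟩
    obtain ⟨a, b, hab⟩ := G.exists_isLink_of_mem_edgeSet he
    exact ⟨a, b, hab, fun h ↦ hx (h ▸ hab.inc_left), fun h ↦ hx (h ▸ hab.inc_right)⟩

theorem excess_deleteVerts_singleton (hV : V(G).Finite) (hE : E(G).Finite) (hx : x ∈ V(G)) :
    (G.deleteVerts {x}).excess = G.excess - (G.incidenceSet x).ncard + 1 := by
  have hEcard := Set.ncard_sdiff_add_ncard_of_subset (G.incidenceSet_subset_edgeSet x) hE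
  have hVcard := Set.ncard_sdiff_singleton_add_one hx hV
  rw [excess, excess, edgeSet_deleteVerts_singleton, vertexSet_deleteVerts]
  omega

theorem le_excess_deleteVerts_add (hG : IsConnectedLeafless G) (hE : E(G).Finite) (hk : 1 ≤ k)
    (hx : x ∈ V(G)) {n : ℕ} (hn : n < (G.incidenceSet x).ncard)
    (hstar : G.starSize x ≤ G.kCorank hE k hk + n) : k ≤ (G.deleteVerts {x}).excess + n := by
  obtain ⟨m, hm⟩ := Nat.exists_eq_add_of_lt hn
  have hlt : m < G.kCorank hE k hk := by
    rw [starSize, ← (hE.subset (G.incidenceSet_subset_edgeSet x)).cast_ncard_eq, hm, add_assoc,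
      add_comm n] at hstar
    push_cast at hstar
    exact (ENat.add_one_le_iff (ENat.natCast_ne_top m)).1
      ((ENat.add_le_add_iff_right (ENat.natCast_ne_top n)).1 hstar)
  rw [hG.lt_kCorank_iff] at hlt
  rw [excess_deleteVerts_singleton (finite_vertexSet hE hG.exists_inc) hE hx]
  omega

theorem injOn_incidenceSet (hG : ∀ x ∈ V(G), IsConnectedLeafless (G.deleteVerts {x})) :
    Set.InjOn G.incidenceSet V(G) := by
  intro x hx y hy hxy
  by_contra hne
  obtain ⟨e, he⟩ := (hG y hy).exists_inc x ⟨hx, hne⟩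
  have hey := he.edge_mem
  rw [edgeSet_deleteVerts_singleton] at hey
  exact hey.2 (hxy.subset (Inc.mono deleteVerts_le he))

theorem excess_le_of_subset_insert_deleteVerts (hE : E(G).Finite)
    (hGx : IsConnectedLeafless (G.deleteVerts {x})) (he : G.Inc e x)
    (hY : Y ⊆ insert e E(G.deleteVerts {x})) :
    (G.edgeInduce Y).excess ≤ max 0 (G.deleteVerts {x}).excess := by
  have hle : G.deleteVerts {x} ≤ G := deleteVerts_le
  have hYe : Y \ {e} ⊆ E(G.deleteVerts {x}) := fun f hf ↦ (hY hf.1).resolve_left hf.2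
  have hbound := hGx.excess_le (hE.subset hle.edgeSet_mono) hYe
  rw [edgeInduce_eq_of_le hle hYe] at hbound
  refine le_trans ?_ hbound
  by_cases heY : e ∈ Y
  · nth_rw 1 [← Set.insert_sdiff_self_of_mem heY]
    refine excess_edgeInduce_insert_le hE (hYe.trans hle.edgeSet_mono) he ?_
    rintro ⟨f, hf, hfx⟩
    exact (edgeSet_deleteVerts_singleton G x ▸ hYe hf).2 hfx
  · rw [Set.sdiff_singleton_eq_self heY]

/-! ### Recovering the stars from the matroid -/

theorem ncard_vertexSet_eq {hE : E(G).Finite} {hE' : E(G').Finite} {hk : 1 ≤ k}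
    (hM : G'.kCircularMatroid hE' k hk = G.kCircularMatroid hE k hk)
    (hG : IsConnectedLeafless G) (hkG : k ≤ G.excess) (hG' : ∀ v ∈ V(G'), ∃ e, G'.Inc e v) :
    V(G').ncard = V(G).ncard := by
  have hedge := edgeSet_eq_of_kCircularMatroid_eq hM
  have hGE := edgeInduce_edgeSet hG.exists_inc
  have hexcess := excess_eq_of_kCircularMatroid_eq hM subset_rfl (hGE.symm ▸ hkG) fun Y hY ↦
    hGE.symm ▸ hG.excess_lt_of_ssubset_of_pos hE (by omega) hY
  rw [hGE, ← hedge, edgeInduce_edgeSet hG', excess, excess, hedge] at hexcess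
  omega

theorem exists_forall_not_inc_of_le_excess {hE : E(G).Finite} {hE' : E(G').Finite} {hk : 1 ≤ k}
    (hM : G'.kCircularMatroid hE' k hk = G.kCircularMatroid hE k hk) (hV : V(G).Finite)
    (hcard : V(G').ncard = V(G).ncard) (hx : x ∈ V(G))
    (hGx : IsConnectedLeafless (G.deleteVerts {x})) (hkx : k ≤ (G.deleteVerts {x}).excess) :
    ∃ v ∈ V(G'), ∀ e ∈ E(G.deleteVerts {x}), ¬ G'.Inc e v := by
  have hle : G.deleteVerts {x} ≤ G := deleteVerts_le
  have hFE : E(G.deleteVerts {x}) ⊆ E(G) := hle.edgeSet_mono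
  have hFfin := hE.subset hFE
  have hFG : (G.edgeInduce E(G.deleteVerts {x})).excess = (G.deleteVerts {x}).excess := by
    rw [← edgeInduce_eq_of_le hle subset_rfl, edgeInduce_edgeSet hGx.exists_inc]
  have hFG' : (G'.edgeInduce E(G.deleteVerts {x})).excess = (G.deleteVerts {x}).excess := by
    rw [excess_eq_of_kCircularMatroid_eq hM hFE (hFG ▸ hkx), hFG]
    intro Y hY
    rw [hFG, ← edgeInduce_eq_of_le hle hY.subset]
    exact hGx.excess_lt_of_ssubset_of_pos hFfin (by omega) hY
  have hVcard := Set.ncard_sdiff_singleton_add_one hx hV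
  rw [excess_edgeInduce (edgeSet_eq_of_kCircularMatroid_eq hM ▸ hFE), excess,
    vertexSet_deleteVerts] at hFG'
  obtain ⟨v, hv, hvF⟩ := Set.exists_mem_notMem_of_ncard_lt_ncard
    (s := V(G'.edgeInduce E(G.deleteVerts {x}))) (t := V(G')) (by omega)
    (G'.vertexSet_edgeInduce_finite hFfin)
  exact ⟨v, hv, fun e he hev ↦ hvF ⟨e, he, hev⟩⟩

theorem incidenceSet_eq_of_forall_not_inc {hE : E(G).Finite} {hE' : E(G').Finite} {hk : 1 ≤ k}
    (hM : G'.kCircularMatroid hE' k hk = G.kCircularMatroid hE k hk) (hV : V(G).Finite)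
    (hV' : V(G').Finite) (hcard : V(G').ncard = V(G).ncard) (hx : x ∈ V(G))
    (hGx : IsConnectedLeafless (G.deleteVerts {x})) (hkx : k - 1 ≤ (G.deleteVerts {x}).excess)
    {v : α'} (hv : v ∈ V(G')) (hvF : ∀ e ∈ E(G.deleteVerts {x}), ¬ G'.Inc e v) :
    G'.incidenceSet v = G.incidenceSet x := by
  have hedge := edgeSet_eq_of_kCircularMatroid_eq hM
  have hFE : E(G.deleteVerts {x}) ⊆ E(G) := deleteVerts_le.edgeSet_mono
  have hF := edgeSet_deleteVerts_singleton G x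
  refine Set.Subset.antisymm (fun e hev ↦ ?_) fun e hex ↦ ?_
  · by_contra hex
    exact hvF e (hF ▸ ⟨hedge ▸ Inc.edge_mem hev, hex⟩) hev
  -- Otherwise adding `e` to `E(G - x)` would add no vertex in `G'` beyond `V(G') \ {v}`.
  by_contra hev
  have heF : insert e E(G.deleteVerts {x}) ⊆ E(G) := Set.insert_subset (Inc.edge_mem hex) hFE
  have hbound := excess_le_of_kCircularMatroid_eq hM heF hkx fun Y hY ↦
    (excess_le_of_subset_insert_deleteVerts hE hGx hex hY).trans_eq (max_eq_right (by omega))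
  have hVsub : V(G'.edgeInduce (insert e E(G.deleteVerts {x}))) ⊆ V(G') \ {v} := by
    rintro u ⟨f, hf, hfu⟩
    refine ⟨hfu.vertex_mem, ?_⟩
    rintro rfl
    exact hf.elim (fun hfe ↦ hev (hfe ▸ hfu)) fun hf ↦ hvF f hf hfu
  have hVcard' := Set.ncard_le_ncard hVsub hV'.sdiff
  have hVv := Set.ncard_sdiff_singleton_add_one hv hV'
  have hVx := Set.ncard_sdiff_singleton_add_one hx hV
  have hFcard := Set.ncard_insert_of_notMem (fun he ↦ (hF ▸ he).2 hex) (hE.subset hFE)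
  rw [excess_edgeInduce (hedge ▸ heF), excess, vertexSet_deleteVerts] at hbound
  omega

theorem exists_incidenceSet_eq_of_le_excess {hE : E(G).Finite} {hE' : E(G').Finite} {hk : 1 ≤ k}
    (hM : G'.kCircularMatroid hE' k hk = G.kCircularMatroid hE k hk) (hV : V(G).Finite)
    (hV' : V(G').Finite) (hcard : V(G').ncard = V(G).ncard) (hx : x ∈ V(G))
    (hGx : IsConnectedLeafless (G.deleteVerts {x})) (hkx : k ≤ (G.deleteVerts {x}).excess) :
    ∃ v ∈ V(G'), G'.incidenceSet v = G.incidenceSet x := by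
  obtain ⟨v, hv, hvF⟩ := exists_forall_not_inc_of_le_excess hM hV hcard hx hGx hkx
  exact ⟨v, hv,
    incidenceSet_eq_of_forall_not_inc hM hV hV' hcard hx hGx (by omega) hv hvF⟩

theorem exists_forall_not_inc_of_forall_ne [G.Loopless] {t : α} (hV : V(G).Finite)
    (hcard : V(G').ncard = V(G).ncard) (ht : t ∈ V(G)) (hinj : Set.InjOn G.incidenceSet V(G))
    (hstar : ∀ x ∈ V(G), x ≠ t → ∃ v ∈ V(G'), G'.incidenceSet v = G.incidenceSet x) :
    ∃ t' ∈ V(G'), ∀ e ∈ E(G.deleteVerts {t}), ¬ G'.Inc e t' := by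
  have hpos := (Set.ncard_pos hV).2 ⟨t, ht⟩
  obtain ⟨v₀, -⟩ := Set.nonempty_of_ncard_ne_zero (hcard.trans_gt hpos).ne'
  have : Nonempty α' := ⟨v₀⟩
  choose! φ _ hφ using hstar
  have hφcard := Set.ncard_image_le (f := φ) (hV.sdiff (t := {t}))
  have htcard := Set.ncard_sdiff_singleton_add_one ht hV
  obtain ⟨t', ht', htφ⟩ := Set.exists_mem_notMem_of_ncard_lt_ncard
    (s := φ '' (V(G) \ {t})) (t := V(G')) (by omega) (hV.sdiff.image φ)
  refine ⟨t', ht', fun e he het' ↦ ?_⟩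
  rw [edgeSet_deleteVerts] at he
  obtain ⟨a, b, hab, ha, hb⟩ := he
  have hea : G'.Inc e (φ a) := (hφ a hab.left_mem ha).superset hab.inc_left
  have heb : G'.Inc e (φ b) := (hφ b hab.right_mem hb).superset hab.inc_right
  have hφab : φ a ≠ φ b := fun h ↦ hab.ne <| hinj hab.left_mem hab.right_mem <| by
    rw [← hφ a hab.left_mem ha, h, hφ b hab.right_mem hb]
  obtain rfl | rfl | h := het'.eq_or_eq_or_eq hea heb
  exacts [htφ ⟨a, ⟨hab.left_mem, ha⟩, rfl⟩, htφ ⟨b, ⟨hab.right_mem, hb⟩, rfl⟩, hφab h]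

theorem exists_equiv_incidenceSet_eq (hV' : V(G').Finite) (hcard : V(G').ncard = V(G).ncard)
    (hinj : Set.InjOn G.incidenceSet V(G))
    (hstar : ∀ x ∈ V(G), ∃ v ∈ V(G'), G'.incidenceSet v = G.incidenceSet x) :
    ∃ ν : V(G) ≃ V(G'), ∀ x : V(G), G'.incidenceSet (ν x) = G.incidenceSet x := by
  choose φ hφmem hφ using hstar
  let ν : V(G) → V(G') := fun x ↦ ⟨φ x x.2, hφmem x x.2⟩
  have hν : ∀ x : V(G), G'.incidenceSet (ν x) = G.incidenceSet x := fun x ↦ hφ x x.2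
  have hνinj : Function.Injective ν := fun x y hxy ↦
    Subtype.ext (hinj x.2 y.2 (by rw [← hν, ← hν, hxy]))
  have := hV'.to_subtype
  exact ⟨.ofBijective ν ((Nat.bijective_iff_injective_and_card ν).2 ⟨hνinj, hcard.symm⟩), hν⟩

theorem starFamily_eq_of_equiv (ν : V(G) ≃ V(G'))
    (hν : ∀ x : V(G), G'.incidenceSet (ν x) = G.incidenceSet x) : G.starFamily = G'.starFamily := by
  ext S
  constructor
  · rintro ⟨x, hx, rfl⟩
    exact ⟨ν ⟨x, hx⟩, (ν ⟨x, hx⟩).2, (hν ⟨x, hx⟩).symm⟩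
  · rintro ⟨v, hv, rfl⟩
    refine ⟨ν.symm ⟨v, hv⟩, (ν.symm ⟨v, hv⟩).2, ?_⟩
    rw [← hν, ν.apply_symm_apply]

theorem stronglyIsomorphic_of_equiv (ν : V(G) ≃ V(G'))
    (hν : ∀ x : V(G), G'.incidenceSet (ν x) = G.incidenceSet x) : G.StronglyIsomorphic G' := by
  have hinc : ∀ e (x : V(G)), G.Inc e x ↔ G'.Inc e (ν x) := fun e x ↦
    Set.ext_iff.1 (hν x).symm e
  refine ⟨Set.ext fun e ↦ ⟨fun he ↦ ?_, fun he ↦ ?_⟩, ν, fun e x y ↦ ?_⟩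
  · obtain ⟨x, y, hxy⟩ := G.exists_isLink_of_mem_edgeSet he
    exact ((hinc e ⟨x, hxy.left_mem⟩).1 hxy.inc_left).edge_mem
  · obtain ⟨v, w, hvw⟩ := G'.exists_isLink_of_mem_edgeSet he
    refine ((hinc e (ν.symm ⟨v, hvw.left_mem⟩)).2 ?_).edge_mem
    rw [ν.apply_symm_apply]
    exact hvw.inc_left
  · have hends : (∀ z, G.Inc e z → z = x ∨ z = y) ↔
        ∀ w, G'.Inc e w → w = ν x ∨ w = ν y := by
      constructor
      · intro h w hw
        obtain ⟨z, rfl⟩ : ∃ z, (ν z : α') = w :=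
          (ν.surjective ⟨w, hw.vertex_mem⟩).imp fun _ ↦ congrArg Subtype.val
        simpa only [Subtype.coe_inj, ν.apply_eq_iff_eq] using h z ((hinc e z).2 hw)
      · intro h z hz
        lift z to V(G) using hz.vertex_mem
        simpa only [Subtype.coe_inj, ν.apply_eq_iff_eq] using h _ ((hinc e z).1 hz)
    rw [isLink_iff_inc, isLink_iff_inc, hinc, hinc, hends]

end KCircular

open KCircular in
theorem mainTheorem4_general {α α' β : Type*} (G : Graph α β) (G' : Graph α' β)
    (hE : G.edgeSet.Finite) (hE' : G'.edgeSet.Finite) (hiso' : ∀ v ∈ G'.vertexSet, ∃ e, G'.Inc e v)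
    (k : ℕ) (hk : 1 ≤ k) (t : α) (ht : t ∈ G.vertexSet) [G.Loopless]
    (hG : ∀ x ∈ G.vertexSet, IsConnectedLeafless (G.deleteVerts {x}))
    (htight : G.starSize t ≤ G.kCorank hE k hk + 1)
    (hsmall : ∀ x ∈ G.vertexSet, x ≠ t → G.IsKSmall hE k hk x)
    (hM : G'.kCircularMatroid hE' k hk = G.kCircularMatroid hE k hk) :
    G.starFamily = G'.starFamily ∧ G.StronglyIsomorphic G' := by
  have hGG := isConnectedLeafless_of_forall_deleteVerts hE ⟨t, ht⟩ hG
  have hV := finite_vertexSet hE hGG.exists_inc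
  have hV' := finite_vertexSet hE' hiso'
  have hdeg := fun x hx ↦ hGG.two_le_ncard_incidenceSet (v := x) hx
  have hkt : (k : ℤ) - 1 ≤ (G.deleteVerts {t}).excess := by
    have := le_excess_deleteVerts_add hGG hE hk ht (hdeg t ht) htight
    omega
  have hkG : k ≤ G.excess := by
    have := excess_deleteVerts_singleton hV hE ht
    have := hdeg t ht
    omega
  have hcard := ncard_vertexSet_eq hM hGG hkG hiso'
  have hinj := injOn_incidenceSet hG
  have hstar : ∀ x ∈ G.vertexSet, x ≠ t → ∃ v ∈ G'.vertexSet,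
      G'.incidenceSet v = G.incidenceSet x := fun x hx hxt ↦
    exists_incidenceSet_eq_of_le_excess hM hV hV' hcard hx (hG x hx) <| by
      simpa using le_excess_deleteVerts_add hGG hE hk hx (n := 0)
        (zero_lt_two.trans_le (hdeg x hx)) (by simpa using Order.le_of_lt_add_one (hsmall x hx hxt))
  obtain ⟨t', ht', htF⟩ := exists_forall_not_inc_of_forall_ne hV hcard ht hinj hstar
  have htstar := incidenceSet_eq_of_forall_not_inc hM hV hV' hcard ht (hG t ht) hkt ht' htF
  obtain ⟨ν, hν⟩ := exists_equiv_incidenceSet_eq hV' hcard hinj fun x hx ↦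
    (eq_or_ne x t).elim (fun hxt ↦ hxt ▸ ⟨t', ht', htstar⟩) (hstar x hx)
  exact ⟨starFamily_eq_of_equiv ν hν, stronglyIsomorphic_of_equiv ν hν⟩

theorem mainTheorem4 {α α' β : Type*} (G : Graph α β) (G' : Graph α' β)
    (hV : G.vertexSet.Finite) (hE : G.edgeSet.Finite)
    (hV' : G'.vertexSet.Finite) (hE' : G'.edgeSet.Finite)
    (hiso' : ∀ v ∈ G'.vertexSet, ∃ e, G'.Inc e v)
    (k : ℕ) (hk : 1 ≤ k) (t : α) (ht : t ∈ G.vertexSet)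
    (hconn : G.IsThreeConnected)
    (hcirc : (G.kCircuits k).Nonempty)
    (htight : G.IsKTight hE k hk t)
    (hsmall : ∀ x ∈ G.vertexSet, x ≠ t → G.IsKSmall hE k hk x)
    (hM : G'.kCircularMatroid hE' k hk = G.kCircularMatroid hE k hk) :
    G.starFamily = G'.starFamily ∧ G.StronglyIsomorphic G' := by
  have := hconn.1
  exact mainTheorem4_general G G' hE hE' hiso' k hk t ht
    (fun _ hx ↦ KCircular.isConnectedLeafless_deleteVerts_of_isThreeConnected hconn hE hx)
    htight.le hsmall hM
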